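/- **Setting.** Let $|\Psi\rangle_{AB}$ be a pure state (unit vector) of $\mathbb C^{a}\otimes\mathbb C^{b}$, $\rho_B=\mathrm{Tr}_A|\Psi\rangle\langle\Psi|$, and let $E_\alpha(\Psi)=\frac1{1-\alpha}\log\mathrm{Tr}[\rho_B^\alpha]$ for $\alpha>0$, $\alpha\ne1$, and $E_1(\Psi)=-\mathrm{Tr}[\rho_B\log\rho_B]$, be its Rényi entanglement entropy. Suppose that a stochastic LOCC protocol (finitely many rounds, in each of which one party performs a local generalised measurement with finitely many outcomes that may depend on all previous outcomes, with possible coarse-graining of the outcomes) transforms $|\Psi\rangle$ into the ensemble of bipartite pure states $\{p_m,|\Psi_m\rangle\}$, with $p_m\ge0$, $\sum_mp_m=1$. For a property of the outcome write $P(\cdot)$ for the sum of the $p_m$ over all outcomes $m$ with this property, and $\Delta E_\alpha(\Psi_m)=E_\alpha(\Psi_m)-E_\alpha(\Psi)$. Let $$\Omega=\{(\alpha,s):0<\alpha<1,\ s\le 1/\alpha\}\cup\{(\alpha,s):\alpha>1,\ s\ge1/\alpha\},$$ and for $E_{\rm target}>0$ put $$B_{\alpha,s}=\frac{e^{s(1-\alpha)E_\alpha(\Psi)}-1}{e^{s(1-\alpha)E_{\rm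 target}}-1},\qquad P^{\rm GEE}_\alpha=\frac{e^{\frac{1-\alpha}{\alpha}E_\alpha(\Psi)}-1}{e^{\frac{1-\alpha}{\alpha}E_{\rm target}}-1},$$ where $B_{\alpha,0}$ is read as its limit $E_\alpha(\Psi)/E_{\rm target}$ and $P^{\rm GEE}_1$ as $E_1(\Psi)/E_{\rm target}$. **Proposition.** 1. For all $(\alpha,s)\in\Omega$ and $E_{\rm target}>0$: $P(E_\alpha\ge E_{\rm target})\le B_{\alpha,s}$. 2. Let $\alpha\in(0,1)\cup(1,\infty)$ and $E_{\rm target}>0$. Then $(\alpha,1/\alpha)\in\Omega$ and $B_{\alpha,1/\alpha}=P^{\rm GEE}_\alpha$. If $E_{\rm target}\ge E_\alpha(\Psi)$, then $s=1/\alpha$ minimises $B_{\alpha,s}$ over all $s$ with $(\alpha,s)\in\Omega$. If $E_{\rm target}<E_\alpha(\Psi)$, then the bound is trivial: $B_{\alpha,s}>1$ for every such $s$. 3. For all $\alpha>0$ and $E_{\rm target}>0$: $P(E_\alpha\ge E_{\rm target})\le P^{\rm GEE}_\alpha$. Moreover $\lim_{\alpha\to1}P^{\rm GEE}_\alpha=P^{\rm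 GEE}_1$. 4. The success probability decays exponentially in the raised entanglement: for $0<\alpha<1$ and all real $x$, $P(\Delta E_\alpha\ge x)\le e^{-\frac{1-\alpha}{\alpha}x}$. -/

import Mathlib

open Matrix
open scoped Kronecker Topology

namespace Entanglement

noncomputable section

/-- Unit vectors of the bipartite Hilbert space `ℂ^a ⊗ ℂ^b`. -/
def PureState (a b : ℕ) : Type :=
  {ψ : EuclideanSpace ℂ (Fin a × Fin b) // ‖ψ‖ = 1}

/-- The rank-one density operator `|Ψ⟩⟨Ψ|`. -/
def PureState.density {a b : ℕ} (Ψ : PureState a b) :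
    Matrix (Fin a × Fin b) (Fin a × Fin b) ℂ :=
  Matrix.of fun x y => Ψ.1 x * star (Ψ.1 y)

/-- The partial trace over the first subsystem. -/
def partialTraceA {a b : ℕ} (ρ : Matrix (Fin a × Fin b) (Fin a × Fin b) ℂ) :
    Matrix (Fin b) (Fin b) ℂ :=
  Matrix.of fun j k => ∑ i, ρ (i, j) (i, k)

/-- The reduced state `ρ_B = Tr_A |Ψ⟩⟨Ψ|`. -/
def PureState.rhoB {a b : ℕ} (Ψ : PureState a b) : Matrix (Fin b) (Fin b) ℂ :=
  partialTraceA Ψ.density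

theorem PureState.rhoB_isHermitian {a b : ℕ} (Ψ : PureState a b) : Ψ.rhoB.IsHermitian := by
  ext j k
  simp [PureState.rhoB, partialTraceA, PureState.density, mul_comm]

/-- The quantum Rényi entropy of order `α` of a density matrix, `(1 - α)⁻¹ log Tr ρ^α` for `α ≠ 1`
and the von Neumann entropy `- Tr (ρ log ρ)` for `α = 1`; here `Tr f(ρ) = ∑ i, f (λ i)` with `λ`
the eigenvalues of `ρ`, counted with multiplicity. -/
def renyiEntropy {b : ℕ} (α : ℝ) (ρ : Matrix (Fin b) (Fin b) ℂ) (hρ : ρ.IsHermitian) : ℝ :=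
  if α = 1 then - ∑ i, hρ.eigenvalues i * Real.log (hρ.eigenvalues i)
  else 1 / (1 - α) * Real.log (∑ i, hρ.eigenvalues i ^ α)

/-- The Rényi entanglement entropy `E_α(Ψ) = S_α(ρ_B)`. -/
def REE {a b : ℕ} (α : ℝ) (Ψ : PureState a b) : ℝ :=
  renyiEntropy α Ψ.rhoB Ψ.rhoB_isHermitian

/-- LOCC protocols with finitely many rounds and finitely many outcomes in each round, acting on
`ℂ^a ⊗ ℂ^b` (the last two indices). In every round one party performs a generalised measurement
given by Kraus operators `K i` with `∑ i, (K i)ᴴ K i = 1` (which may change the local dimension),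
announces the outcome `i`, and the rest of the protocol may depend on `i`. A run of the protocol
ends by reporting a label `m : ι`, with the final system being `ℂ^(a' m) ⊗ ℂ^(b' m)`; several runs
may report the same label (coarse-graining). -/
inductive Protocol {ι : Type*} (a' b' : ι → ℕ) : ℕ → ℕ → Type _
  | report (m : ι) : Protocol a' b' (a' m) (b' m)
  | alice {a b : ℕ} (n : ℕ) (d : Fin n → ℕ) (K : ∀ i, Matrix (Fin (d i)) (Fin a) ℂ)
      (hK : ∑ i, (K i)ᴴ * K i = 1) (next : ∀ i, Protocol a' b' (d i) b) : Protocol a' b' a b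
  | bob {a b : ℕ} (n : ℕ) (d : Fin n → ℕ) (K : ∀ i, Matrix (Fin (d i)) (Fin b) ℂ)
      (hK : ∑ i, (K i)ᴴ * K i = 1) (next : ∀ i, Protocol a' b' a (d i)) : Protocol a' b' a b

open Classical in
/-- The quantum instrument realised by a protocol: `P.apply ρ m` is the unnormalised density
operator that goes with the label `m`, that is, the sum over all runs that report `m`. -/
def Protocol.apply {ι : Type*} {a' b' : ι → ℕ} : {a b : ℕ} → Protocol a' b' a b →
    Matrix (Fin a × Fin b) (Fin a × Fin b) ℂ →
    (m : ι) → Matrix (Fin (a' m) × Fin (b' m)) (Fin (a' m) × Fin (b' m)) ℂ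
  | _, _, .report m₀, ρ => Pi.single m₀ ρ
  | _, b, .alice _ _ K _ next, ρ => ∑ i, (next i).apply
      ((K i ⊗ₖ (1 : Matrix (Fin b) (Fin b) ℂ)) * ρ * (K i ⊗ₖ (1 : Matrix (Fin b) (Fin b) ℂ))ᴴ)
  | a, _, .bob _ _ K _ next, ρ => ∑ i, (next i).apply
      (((1 : Matrix (Fin a) (Fin a) ℂ) ⊗ₖ K i) * ρ * ((1 : Matrix (Fin a) (Fin a) ℂ) ⊗ₖ K i)ᴴ)

/-- An ensemble `{p_m, Ψ_m}` of bipartite pure states, with outcomes labelled by `ι`. -/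
structure Ensemble (ι : Type*) [Fintype ι] (a' b' : ι → ℕ) where
  p : ι → ℝ
  p_nonneg : ∀ m, 0 ≤ p m
  p_sum : ∑ m, p m = 1
  state : ∀ m, PureState (a' m) (b' m)

/-- `Ψ` is transformed by some SLOCC protocol into the ensemble `{p_m, Ψ_m}`. -/
def SLOCC {a b : ℕ} {ι : Type*} [Fintype ι] {a' b' : ι → ℕ}
    (Ψ : PureState a b) (𝓔 : Ensemble ι a' b') : Prop :=
  ∃ P : Protocol a' b' a b, ∀ m, P.apply Ψ.density m = (𝓔.p m : ℂ) • (𝓔.state m).density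

open Classical in
/-- The accumulated probability of the outcomes in `Γ`. -/
def Ensemble.prob {ι : Type*} [Fintype ι] {a' b' : ι → ℕ} (𝓔 : Ensemble ι a' b') (Γ : Set ι) : ℝ :=
  ∑ m with m ∈ Γ, 𝓔.p m

/-- The parameter region `Ω`. -/
def Omega : Set (ℝ × ℝ) :=
  {x | 0 < x.1 ∧ x.1 < 1 ∧ x.2 ≤ 1 / x.1} ∪ {x | 1 < x.1 ∧ 1 / x.1 ≤ x.2}

/-- `(e^{s(1-α)E} - 1) / (e^{s(1-α)T} - 1)`, with its limiting value `E / T` where the exponents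
vanish identically, that is for `s (1 - α) = 0`. -/
def ratioBound (α s E T : ℝ) : ℝ :=
  if s * (1 - α) = 0 then E / T
  else (Real.exp (s * (1 - α) * E) - 1) / (Real.exp (s * (1 - α) * T) - 1)

/-- The bound `P^GEE_α` for the state `Ψ` and the target `T`, with the value `E_1(Ψ) / T` for
`α = 1`. -/
def PGEE {a b : ℕ} (α : ℝ) (Ψ : PureState a b) (T : ℝ) : ℝ :=
  if α = 1 then REE 1 Ψ / T
  else (Real.exp ((1 - α) / α * REE α Ψ) - 1) / (Real.exp ((1 - α) / α * T) - 1)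

end

end Entanglement

/-! The function `exp ((1 - α) / α * E_α)` of a pure state is the Schatten quasi-norm `(Tr ρ_B ^ α)
^ (1 / α)`. This is superadditive on positive semidefinite matrices for `α ≤ 1` and subadditive for
`α ≥ 1`: both follow from Minkowski's inequality for vectors, after comparing diagonals in an
eigenbasis of the sum.

A protocol therefore cannot increase its average for `α ≤ 1`, nor decrease it for `α ≥ 1`. A
measurement by Alice only decomposes `ρ_B = C * Cᴴ`, where `C` is the coefficient matrix; a
measurement by Bob decomposes `Cᴴ * C`, which has the same nonzero spectrum. Coarse-graining is
harmless, because positive operators adding up to a pure state are all proportional to it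
(`Protocol.sum_mul_le`).

Markov's inequality, applied to the distance of the quasi-norm from its value 1 on product states,
gives `PGEE`; `α = 1` is the limit of this monotonicity from below. Finally, the bound as a function
of `c = s * (1 - α)` is a secant slope of a concave power, hence decreasing in `c` for `E ≤ T`, and
`s = 1 / α` is the largest admissible `c`. -/

open scoped ComplexOrder

/-! ### Minkowski inequalities for nonnegative vectors -/

namespace Real

variable {n κ : Type*} [Fintype n]

/-- Minkowski's inequality for finitely many nonnegative vectors. -/
theorem Lp_sum_le_of_nonneg {p : ℝ} (hp : 1 ≤ p) (s : Finset κ) (d : κ → n → ℝ)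
    (hd : ∀ i k, 0 ≤ d i k) :
    (∑ k, (∑ i ∈ s, d i k) ^ p) ^ (1 / p) ≤ ∑ i ∈ s, (∑ k, d i k ^ p) ^ (1 / p) := by
  classical
  have hp0 : p ≠ 0 := by positivity
  induction s using Finset.induction_on with
  | empty => simp [zero_rpow hp0, zero_rpow (inv_ne_zero hp0)]
  | insert i s hi ih =>
    simp only [Finset.sum_insert hi]
    refine (Lp_add_le_of_nonneg Finset.univ hp (fun k _ => hd i k)
      (fun k _ => Finset.sum_nonneg fun j _ => hd j k)).trans ?_
    gcongr

/-- The reverse Minkowski inequality for exponents in `(0, 1]`. -/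
theorem sum_Lp_le_of_nonneg [Fintype κ] {p : ℝ} (hp : 0 < p) (hp1 : p ≤ 1) (d : κ → n → ℝ)
    (hd : ∀ i k, 0 ≤ d i k) :
    ∑ i, (∑ k, d i k ^ p) ^ (1 / p) ≤ (∑ k, (∑ i, d i k) ^ p) ^ (1 / p) := by
  classical
  -- Minkowski with exponent `1 / p ≥ 1` for the `p`-th powers, with the roles of the two indices
  -- exchanged.
  have h := Lp_sum_le_of_nonneg (one_le_one_div hp hp1) Finset.univ
    (fun k i => d i k ^ p) (fun k i => rpow_nonneg (hd i k) p)
  have e : ∀ i k, (d i k ^ p) ^ (1 / p) = d i k := fun i k => by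
    rw [one_div, rpow_rpow_inv (hd i k) hp.ne']
  simp only [e, one_div_one_div] at h
  rw [one_div p] at h ⊢
  have h0 : 0 ≤ ∑ i, (∑ k, d i k ^ p) ^ p⁻¹ :=
    Finset.sum_nonneg fun i _ => rpow_nonneg
      (Finset.sum_nonneg fun k _ => rpow_nonneg (hd i k) p) _
  have h1 := rpow_le_rpow (rpow_nonneg h0 _) h (inv_nonneg.2 hp.le)
  rwa [rpow_rpow_inv h0 hp.ne'] at h1

theorem mul_Lp_of_nonneg {c p : ℝ} (hc : 0 ≤ c) (hp : 0 < p) (d : n → ℝ) (hd : ∀ k, 0 ≤ d k) :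
    c * (∑ k, d k ^ p) ^ (1 / p) = (∑ k, (c * d k) ^ p) ^ (1 / p) := by
  simp only [mul_rpow hc (hd _), ← Finset.mul_sum]
  rw [mul_rpow (rpow_nonneg hc p)
    (Finset.sum_nonneg fun k _ => rpow_nonneg (hd k) p), one_div,
    rpow_rpow_inv hc hp.ne']

end Real

/-! ### Trace powers and Schatten quasi-norms -/

/-- `Tr A ^ α`, computed from the roots of the characteristic polynomial. -/
noncomputable def Matrix.tracePow {n : Type*} [Fintype n] [DecidableEq n] (α : ℝ)
    (A : Matrix n n ℂ) : ℝ :=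
  (A.charpoly.roots.map fun z => z.re ^ α).sum

/-- The Schatten quasi-norm `(Tr A ^ α) ^ (1 / α)` of a positive semidefinite matrix. -/
noncomputable def Matrix.schatten {n : Type*} [Fintype n] [DecidableEq n] (α : ℝ)
    (A : Matrix n n ℂ) : ℝ :=
  A.tracePow α ^ (1 / α)

namespace Matrix

variable {m n κ : Type*} [Fintype m] [DecidableEq m] [Fintype n] [DecidableEq n] [Fintype κ]

theorem IsHermitian.tracePow_eq {A : Matrix n n ℂ} (hA : A.IsHermitian) (α : ℝ) :
    A.tracePow α = ∑ i, hA.eigenvalues i ^ α := by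
  simp [tracePow, hA.roots_charpoly_eq_eigenvalues]

/-- The two characteristic polynomials agree up to powers of `X`, and the extra zero roots
contribute `0 ^ α = 0`. -/
theorem tracePow_mul_comm {α : ℝ} (hα : α ≠ 0) (A : Matrix m n ℂ) (B : Matrix n m ℂ) :
    (A * B).tracePow α = (B * A).tracePow α := by
  have h := congrArg (fun p : Polynomial ℂ => (p.roots.map fun z : ℂ => z.re ^ α).sum)
    (charpoly_mul_comm' A B)
  have key : ∀ (k : ℕ) (p : Polynomial ℂ), p ≠ 0 →
      ((Polynomial.X ^ k * p).roots.map fun z : ℂ => z.re ^ α).sum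
        = (p.roots.map fun z : ℂ => z.re ^ α).sum := by
    intro k p hp
    rw [Polynomial.roots_mul (mul_ne_zero (pow_ne_zero _ Polynomial.X_ne_zero) hp)]
    simp [Multiset.map_nsmul, Multiset.sum_nsmul, Real.zero_rpow hα]
  simpa only [key _ _ (charpoly_monic _).ne_zero, tracePow] using h

theorem schatten_mul_comm {α : ℝ} (hα : α ≠ 0) (A : Matrix m n ℂ) (B : Matrix n m ℂ) :
    (A * B).schatten α = (B * A).schatten α := by
  rw [schatten, schatten, tracePow_mul_comm hα]

/-- The diagonal of a Hermitian matrix in an orthonormal basis is a doubly stochastic average of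
its eigenvalues. -/
theorem IsHermitian.exists_doublyStochastic {A : Matrix n n ℂ} (hA : A.IsHermitian)
    (U : unitaryGroup n ℂ) :
    ∃ S ∈ doublyStochastic ℝ n, ∀ k,
      (((star U : Matrix n n ℂ) * A * (U : Matrix n n ℂ)) k k).re
        = ∑ j, S k j * hA.eigenvalues j := by
  set W : unitaryGroup n ℂ := star U * hA.eigenvectorUnitary with hW
  have h1 : (W : Matrix n n ℂ) * star (W : Matrix n n ℂ) = 1 := Unitary.coe_mul_star_self W
  have h2 : star (W : Matrix n n ℂ) * (W : Matrix n n ℂ) = 1 := Unitary.coe_star_mul_self W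
  -- The weights are the squared overlaps of the given basis with the eigenbasis; unitarity of `W`
  -- makes rows and columns sum to one.
  refine ⟨of fun k j => Complex.normSq ((W : Matrix n n ℂ) k j), ?_, fun k => ?_⟩
  · rw [mem_doublyStochastic_iff_sum]
    refine ⟨fun i j => Complex.normSq_nonneg _, fun i => ?_, fun j => ?_⟩
    · have := congrFun (congrFun h1 i) i
      simp only [mul_apply, star_apply, one_apply_eq, RCLike.star_def, Complex.mul_conj] at this
      exact_mod_cast this
    · have := congrFun (congrFun h2 j) j
      simp only [mul_apply, star_apply, one_apply_eq, RCLike.star_def, mul_comm,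
        Complex.mul_conj] at this
      exact_mod_cast this
  · have h3 : (star U : Matrix n n ℂ) * A * (U : Matrix n n ℂ)
        = (W : Matrix n n ℂ) * diagonal (fun j => (hA.eigenvalues j : ℂ)) *
          star (W : Matrix n n ℂ) := by
      conv_lhs => rw [hA.spectral_theorem]
      simp only [Unitary.conjStarAlgAut_apply, hW, Submonoid.coe_mul, star_mul, Unitary.coe_star,
        star_star, Matrix.mul_assoc]
      rfl
    rw [h3, mul_apply, Complex.re_sum]
    refine Finset.sum_congr rfl fun j _ => ?_
    rw [mul_diagonal, star_apply, mul_right_comm, RCLike.star_def, Complex.mul_conj,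
      ← Complex.ofReal_mul, Complex.ofReal_re, of_apply]

theorem IsHermitian.re_diag_eigenvectorUnitary {A : Matrix n n ℂ} (hA : A.IsHermitian) (k : n) :
    (((star hA.eigenvectorUnitary : Matrix n n ℂ) * A *
      (hA.eigenvectorUnitary : Matrix n n ℂ)) k k).re = hA.eigenvalues k := by
  have h := hA.conjStarAlgAut_star_eigenvectorUnitary
  rw [Unitary.conjStarAlgAut_apply] at h
  simp only [Unitary.coe_star, star_star] at h
  rw [h]
  simp

/-- Jensen's inequality in each row, then the column sums. -/
theorem sum_le_of_doublyStochastic {S : Matrix n n ℝ} (hS : S ∈ doublyStochastic ℝ n)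
    {f : ℝ → ℝ} (hf : ConvexOn ℝ (Set.Ici 0) f) {x : n → ℝ} (hx : ∀ j, 0 ≤ x j) :
    ∑ k, f (∑ j, S k j * x j) ≤ ∑ j, f (x j) := by
  rw [mem_doublyStochastic_iff_sum] at hS
  obtain ⟨h0, hr, hc⟩ := hS
  calc ∑ k, f (∑ j, S k j * x j) ≤ ∑ k, ∑ j, S k j * f (x j) :=
        Finset.sum_le_sum fun k _ => by
          simpa using hf.map_sum_le (t := Finset.univ) (w := fun j => S k j) (p := x)
            (fun j _ => h0 k j) (hr k) (fun j _ => hx j)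
    _ = ∑ j, f (x j) := by
        rw [Finset.sum_comm]
        simp [← Finset.sum_mul, hc]

theorem PosSemidef.tracePow_nonneg {A : Matrix n n ℂ} (hA : A.PosSemidef) (α : ℝ) :
    0 ≤ A.tracePow α := by
  rw [hA.1.tracePow_eq]
  exact Finset.sum_nonneg fun i _ => Real.rpow_nonneg (hA.eigenvalues_nonneg i) _

theorem PosSemidef.sum_diag_rpow_le {A : Matrix n n ℂ} (hA : A.PosSemidef) (U : unitaryGroup n ℂ)
    {α : ℝ} (hα : 1 ≤ α) :
    ∑ k, ((((star U : Matrix n n ℂ) * A * (U : Matrix n n ℂ)) k k).re) ^ α ≤ A.tracePow α := by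
  obtain ⟨S, hS, h⟩ := hA.1.exists_doublyStochastic U
  simp only [h, hA.1.tracePow_eq]
  exact sum_le_of_doublyStochastic hS (convexOn_rpow hα) hA.eigenvalues_nonneg

theorem PosSemidef.tracePow_le_sum_diag_rpow {A : Matrix n n ℂ} (hA : A.PosSemidef)
    (U : unitaryGroup n ℂ) {α : ℝ} (hα : 0 ≤ α) (hα1 : α ≤ 1) :
    A.tracePow α ≤ ∑ k, ((((star U : Matrix n n ℂ) * A * (U : Matrix n n ℂ)) k k).re) ^ α := by
  obtain ⟨S, hS, h⟩ := hA.1.exists_doublyStochastic U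
  simp only [h, hA.1.tracePow_eq]
  simpa using sum_le_of_doublyStochastic hS (Real.concaveOn_rpow hα hα1).neg hA.eigenvalues_nonneg

theorem PosSemidef.re_diag_nonneg {A : Matrix n n ℂ} (hA : A.PosSemidef) (U : unitaryGroup n ℂ)
    (k : n) : 0 ≤ (((star U : Matrix n n ℂ) * A * (U : Matrix n n ℂ)) k k).re := by
  have h := (hA.conjTranspose_mul_mul_same (U : Matrix n n ℂ)).diag_nonneg (i := k)
  exact (Complex.le_def.1 h).1

theorem re_diag_sum_smul (U : unitaryGroup n ℂ) (c : κ → ℝ) (X : κ → Matrix n n ℂ) (k : n) :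
    (((star U : Matrix n n ℂ) * (∑ i, (c i : ℂ) • X i) * (U : Matrix n n ℂ)) k k).re
      = ∑ i, c i * (((star U : Matrix n n ℂ) * X i * (U : Matrix n n ℂ)) k k).re := by
  simp [Matrix.mul_sum, Matrix.sum_mul, Matrix.sum_apply]

theorem posSemidef_sum_smul {l : Type*} {c : κ → ℝ} (hc : ∀ i, 0 ≤ c i) {X : κ → Matrix l l ℂ}
    (hX : ∀ i, (X i).PosSemidef) : (∑ i, (c i : ℂ) • X i).PosSemidef :=
  posSemidef_sum _ fun i _ => (hX i).smul (Complex.zero_le_real.2 (hc i))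

/-- Schatten quasi-norms of order `α ≤ 1` are superadditive on positive semidefinite matrices. -/
theorem sum_schatten_le {α : ℝ} (hα : 0 < α) (hα1 : α ≤ 1) {c : κ → ℝ} (hc : ∀ i, 0 ≤ c i)
    {X : κ → Matrix n n ℂ} (hX : ∀ i, (X i).PosSemidef) :
    ∑ i, c i * (X i).schatten α ≤ (∑ i, (c i : ℂ) • X i).schatten α := by
  have hS := posSemidef_sum_smul hc hX
  -- In an eigenbasis of the sum, passing to diagonals loses nothing for the sum and has the
  -- favourable sign for every summand, which leaves an inequality between vectors.
  set U := hS.1.eigenvectorUnitary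
  have hd := fun i k => (hX i).re_diag_nonneg U k
  calc ∑ i, c i * (X i).schatten α
      ≤ ∑ i, c i * (∑ k,
        ((((star U : Matrix n n ℂ) * X i * (U : Matrix n n ℂ)) k k).re) ^ α) ^ (1 / α) := by
        refine Finset.sum_le_sum fun i _ => mul_le_mul_of_nonneg_left ?_ (hc i)
        exact Real.rpow_le_rpow ((hX i).tracePow_nonneg α)
          ((hX i).tracePow_le_sum_diag_rpow U hα.le hα1) (one_div_nonneg.2 hα.le)
    _ = ∑ i, (∑ k, (c i *
        (((star U : Matrix n n ℂ) * X i * (U : Matrix n n ℂ)) k k).re) ^ α) ^ (1 / α) :=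
        Finset.sum_congr rfl fun i _ => Real.mul_Lp_of_nonneg (hc i) hα _ (hd i)
    _ ≤ _ := Real.sum_Lp_le_of_nonneg hα hα1 _ fun i k => mul_nonneg (hc i) (hd i k)
    _ = _ := by
        simp only [← re_diag_sum_smul, schatten, hS.1.tracePow_eq, U,
          hS.1.re_diag_eigenvectorUnitary]

/-- Schatten norms of order `1 ≤ α` are subadditive on positive semidefinite matrices. -/
theorem schatten_sum_le {α : ℝ} (hα : 1 ≤ α) {c : κ → ℝ} (hc : ∀ i, 0 ≤ c i)
    {X : κ → Matrix n n ℂ} (hX : ∀ i, (X i).PosSemidef) :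
    (∑ i, (c i : ℂ) • X i).schatten α ≤ ∑ i, c i * (X i).schatten α := by
  have hα0 : 0 < α := by positivity
  have hS := posSemidef_sum_smul hc hX
  set U := hS.1.eigenvectorUnitary
  have hd := fun i k => (hX i).re_diag_nonneg U k
  calc (∑ i, (c i : ℂ) • X i).schatten α
      = (∑ k, (∑ i, c i *
        (((star U : Matrix n n ℂ) * X i * (U : Matrix n n ℂ)) k k).re) ^ α) ^ (1 / α) := by
        simp only [← re_diag_sum_smul, schatten, hS.1.tracePow_eq, U,
          hS.1.re_diag_eigenvectorUnitary]
    _ ≤ ∑ i, (∑ k, (c i *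
        (((star U : Matrix n n ℂ) * X i * (U : Matrix n n ℂ)) k k).re) ^ α) ^ (1 / α) :=
        Real.Lp_sum_le_of_nonneg hα _ _ fun i k => mul_nonneg (hc i) (hd i k)
    _ = ∑ i, c i * (∑ k,
        ((((star U : Matrix n n ℂ) * X i * (U : Matrix n n ℂ)) k k).re) ^ α) ^ (1 / α) :=
        (Finset.sum_congr rfl fun i _ => Real.mul_Lp_of_nonneg (hc i) hα0 _ (hd i)).symm
    _ ≤ _ := by
        refine Finset.sum_le_sum fun i _ => mul_le_mul_of_nonneg_left ?_ (hc i)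
        exact Real.rpow_le_rpow (Finset.sum_nonneg fun k _ => Real.rpow_nonneg (hd i k) _)
          ((hX i).sum_diag_rpow_le U hα) (one_div_nonneg.2 hα0.le)

end Matrix

/-! ### Positive decompositions of a pure state -/

namespace Matrix

/-- If positive semidefinite matrices add up to a multiple of the projection onto a unit vector,
then each of them is a multiple of that projection. -/
theorem eq_smul_vecMulVec_of_sum_eq {n κ : Type*} [Fintype n] [DecidableEq n] [Fintype κ]
    {A : κ → Matrix n n ℂ} (hA : ∀ i, (A i).PosSemidef) {u : n → ℂ} (hu : star u ⬝ᵥ u = 1)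
    {q : ℂ} (h : ∑ i, A i = q • vecMulVec u (star u)) :
    ∃ c : κ → ℝ, (∀ i, 0 ≤ c i) ∧ (∀ i, A i = (c i : ℂ) • vecMulVec u (star u)) ∧
      ∑ i, (c i : ℂ) = q := by
  -- On the complement of `u` the nonnegative quadratic forms add up to zero, so each vanishes
  -- there.
  have hzero : ∀ i x, star u ⬝ᵥ x = 0 → A i *ᵥ x = 0 := by
    intro i x hx
    have hs : ∑ i, star x ⬝ᵥ (A i *ᵥ x) = 0 := by
      rw [← dotProduct_sum, ← sum_mulVec, h, smul_mulVec, vecMulVec_mulVec, hx]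
      simp
    exact ((hA i).dotProduct_mulVec_zero_iff x).1
      ((Finset.sum_eq_zero_iff_of_nonneg fun i _ => (hA i).dotProduct_mulVec_nonneg x).1 hs i
        (Finset.mem_univ i))
  set p := vecMulVec u (star u) with hp
  have hpH : pᴴ = p := by simp [hp, conjTranspose_vecMulVec]
  -- Each basis vector differs from its projection by a vector orthogonal to `u`, which `A i` kills.
  have hAp : ∀ i, A i * p = A i := by
    intro i
    refine Matrix.ext_of_mulVec_single fun j => ?_
    have h0 := hzero i (Pi.single j 1 - p *ᵥ Pi.single j 1) (by
      rw [dotProduct_sub, hp, vecMulVec_mulVec, dotProduct_smul, hu]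
      simp)
    rw [mulVec_sub, sub_eq_zero] at h0
    rw [← mulVec_mulVec, ← h0]
  have hpA : ∀ i, p * A i = A i := by
    intro i
    have := congrArg conjTranspose (hAp i)
    rwa [conjTranspose_mul, hpH, (hA i).1.eq] at this
  have hc : ∀ i, A i = (star u ⬝ᵥ A i *ᵥ u) • p := by
    intro i
    calc A i = p * (A i * p) := by rw [hAp, hpA]
      _ = _ := by rw [hp, mul_vecMulVec, vecMulVec_mul_vecMulVec, vecMulVec_smul]
  have hr : ∀ i, (((star u ⬝ᵥ A i *ᵥ u).re : ℝ) : ℂ) = star u ⬝ᵥ A i *ᵥ u := fun i =>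
    (Complex.eq_re_of_ofReal_le ((hA i).dotProduct_mulVec_nonneg u)).symm
  refine ⟨fun i => (star u ⬝ᵥ A i *ᵥ u).re,
    fun i => (Complex.le_def.1 ((hA i).dotProduct_mulVec_nonneg u)).1, fun i => ?_, ?_⟩
  · rw [hr, ← hc]
  · simp only [hr]
    rw [← dotProduct_sum, ← sum_mulVec, h, smul_mulVec, hp, vecMulVec_mulVec, hu]
    simp [hu]

end Matrix

/-! ### Monotones under protocols -/

namespace Entanglement

/-- The coefficients of a bipartite vector as a matrix from the first to the second subsystem. -/
def coeffMatrix {a b : ℕ} (v : Fin a × Fin b → ℂ) : Matrix (Fin b) (Fin a) ℂ :=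
  of fun j i => v (i, j)

variable {a b : ℕ}

theorem partialTraceA_vecMulVec (v : Fin a × Fin b → ℂ) :
    partialTraceA (vecMulVec v (star v)) = coeffMatrix v * (coeffMatrix v)ᴴ := by
  ext j k
  simp [partialTraceA, coeffMatrix, mul_apply, vecMulVec_apply]

theorem PureState.density_eq (Ψ : PureState a b) :
    Ψ.density = vecMulVec (Ψ.1 : Fin a × Fin b → ℂ) (star (Ψ.1 : Fin a × Fin b → ℂ)) := by
  ext x y
  simp [PureState.density, vecMulVec_apply]

theorem PureState.dotProduct_self (Ψ : PureState a b) :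
    star (Ψ.1 : Fin a × Fin b → ℂ) ⬝ᵥ (Ψ.1 : Fin a × Fin b → ℂ) = 1 := by
  have h := EuclideanSpace.inner_eq_star_dotProduct Ψ.1 Ψ.1
  rw [inner_self_eq_norm_sq_to_K, Ψ.2, dotProduct_comm] at h
  simpa using h.symm

theorem PureState.rhoB_eq (Ψ : PureState a b) :
    Ψ.rhoB = coeffMatrix Ψ.1 * (coeffMatrix Ψ.1)ᴴ := by
  rw [PureState.rhoB, Ψ.density_eq, partialTraceA_vecMulVec]

theorem PureState.rhoB_posSemidef (Ψ : PureState a b) : Ψ.rhoB.PosSemidef := by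
  rw [Ψ.rhoB_eq]
  exact posSemidef_self_mul_conjTranspose _

theorem PureState.trace_rhoB (Ψ : PureState a b) : Ψ.rhoB.trace = 1 := by
  rw [← Ψ.dotProduct_self]
  simp only [trace, diag_apply, PureState.rhoB, partialTraceA, of_apply, PureState.density,
    dotProduct, Fintype.sum_prod_type, Pi.star_apply, mul_comm]
  exact Finset.sum_comm

/-- Alice acts on the coefficient matrix from the right and Bob from the left, so each leaves one of
the two Gram matrices unchanged on average. -/
theorem coeffMatrix_kronecker_one {d : ℕ} (K : Matrix (Fin d) (Fin a) ℂ)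
    (v : Fin a × Fin b → ℂ) :
    coeffMatrix ((K ⊗ₖ (1 : Matrix (Fin b) (Fin b) ℂ)) *ᵥ v) = coeffMatrix v * Kᵀ := by
  ext j i
  simp [coeffMatrix, mul_apply, mulVec, dotProduct, Fintype.sum_prod_type, one_apply, mul_comm]

theorem coeffMatrix_one_kronecker {d : ℕ} (K : Matrix (Fin d) (Fin b) ℂ)
    (v : Fin a × Fin b → ℂ) :
    coeffMatrix (((1 : Matrix (Fin a) (Fin a) ℂ) ⊗ₖ K) *ᵥ v) = K * coeffMatrix v := by
  ext j i
  simp [coeffMatrix, mul_apply, mulVec, dotProduct, Fintype.sum_prod_type, one_apply]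

theorem conj_vecMulVec {m n : Type*} [Fintype n] (K : Matrix m n ℂ) (v : n → ℂ) :
    K * vecMulVec v (star v) * Kᴴ = vecMulVec (K *ᵥ v) (star (K *ᵥ v)) := by
  rw [mul_vecMulVec, vecMulVec_mul, star_mulVec]

variable {ι : Type*} {a' b' : ι → ℕ}

theorem Protocol.apply_posSemidef (P : Protocol a' b' a b) :
    ∀ {ρ : Matrix (Fin a × Fin b) (Fin a × Fin b) ℂ}, ρ.PosSemidef →
      ∀ m, (P.apply ρ m).PosSemidef := by
  classical
  induction P with
  | report m₀ =>
    intro ρ hρ m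
    rw [Protocol.apply]
    rcases eq_or_ne m m₀ with rfl | hm
    · simpa using hρ
    · rw [Pi.single_eq_of_ne hm]
      exact PosSemidef.zero
  | alice n d K hK next ih =>
    intro ρ hρ m
    rw [Protocol.apply, Finset.sum_apply]
    exact posSemidef_sum _ fun i _ => ih i (hρ.mul_mul_conjTranspose_same _) m
  | bob n d K hK next ih =>
    intro ρ hρ m
    rw [Protocol.apply, Finset.sum_apply]
    exact posSemidef_sum _ fun i _ => ih i (hρ.mul_mul_conjTranspose_same _) m

section Monotone

variable [Fintype ι] (F : ∀ n : ℕ, Matrix (Fin n) (Fin n) ℂ → ℝ)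

/-- If a family of protocols together yields an ensemble of pure states, then each of them does,
and the averages add up. -/
theorem sum_le_of_runs {n : ℕ} {A B : Fin n → ℕ} (P : ∀ i, Protocol a' b' (A i) (B i))
    (ih : ∀ i (v : Fin (A i) × Fin (B i) → ℂ) (q : ι → ℝ), (∀ m, 0 ≤ q m) →
      ∀ u : ∀ m, PureState (a' m) (b' m),
      (∀ m, (P i).apply (vecMulVec v (star v)) m = (q m : ℂ) • (u m).density) →
      ∑ m, q m * F _ (u m).rhoB ≤ F _ (coeffMatrix v * (coeffMatrix v)ᴴ))
    (v : ∀ i, Fin (A i) × Fin (B i) → ℂ) (q : ι → ℝ) (u : ∀ m, PureState (a' m) (b' m))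
    (h : ∀ m, ∑ i, (P i).apply (vecMulVec (v i) (star (v i))) m = (q m : ℂ) • (u m).density) :
    ∑ m, q m * F _ (u m).rhoB ≤ ∑ i, F _ (coeffMatrix (v i) * (coeffMatrix (v i))ᴴ) := by
  -- All runs reporting `m` together give a multiple of one pure state, so each run does so by
  -- itself.
  have hc : ∀ m, ∃ c : Fin n → ℝ, (∀ i, 0 ≤ c i) ∧
      (∀ i, (P i).apply (vecMulVec (v i) (star (v i))) m = (c i : ℂ) • (u m).density) ∧
      ∑ i, (c i : ℂ) = q m := by
    intro m
    have hm := h m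
    rw [(u m).density_eq] at hm ⊢
    exact eq_smul_vecMulVec_of_sum_eq
      (fun i => (P i).apply_posSemidef (posSemidef_vecMulVec_self_star _) m)
      (u m).dotProduct_self hm
  choose c hc0 hc1 hc2 using hc
  have hq : ∀ m, q m = ∑ i, c m i := fun m => by
    have := hc2 m
    exact_mod_cast this.symm
  calc ∑ m, q m * F _ (u m).rhoB = ∑ i, ∑ m, c m i * F _ (u m).rhoB := by
        rw [Finset.sum_comm]
        simp only [hq, Finset.sum_mul]
    _ ≤ _ := Finset.sum_le_sum fun i _ =>
        ih i (v i) (fun m => c m i) (fun m => hc0 m i) u fun m => hc1 m i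

variable
  (hF : ∀ (n k : ℕ) (c : Fin k → ℝ) (X : Fin k → Matrix (Fin n) (Fin n) ℂ), (∀ i, 0 ≤ c i) →
    (∀ i, (X i).PosSemidef) → ∑ i, c i * F n (X i) ≤ F n (∑ i, (c i : ℂ) • X i))
  (hFcomm : ∀ (m n : ℕ) (A : Matrix (Fin m) (Fin n) ℂ), F m (A * Aᴴ) = F n (Aᴴ * A))

include hF hFcomm

/-- A functional of the reduced state that is superadditive and depends only on the nonzero part of
the spectrum does not increase on average under a protocol with pure outcomes. -/
theorem Protocol.sum_mul_le (P : Protocol a' b' a b) :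
    ∀ (v : Fin a × Fin b → ℂ) (q : ι → ℝ), (∀ m, 0 ≤ q m) →
      ∀ u : ∀ m, PureState (a' m) (b' m),
      (∀ m, P.apply (vecMulVec v (star v)) m = (q m : ℂ) • (u m).density) →
      ∑ m, q m * F _ (u m).rhoB ≤ F _ (coeffMatrix v * (coeffMatrix v)ᴴ) := by
  classical
  have hF' : ∀ (n k : ℕ) (X : Fin k → Matrix (Fin n) (Fin n) ℂ),
      (∀ i, (X i).PosSemidef) → ∑ i, F n (X i) ≤ F n (∑ i, X i) := fun n k X hX => by
    simpa using hF n k (fun _ => 1) X (fun _ => zero_le_one) hX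
  induction P with
  | report m₀ =>
    intro v q hq u h
    -- The other labels receive the zero operator, and the trace shows that their weights vanish.
    have h0 : ∀ m ≠ m₀, q m = 0 := by
      intro m hm
      have := congrArg trace (h m)
      rw [Protocol.apply, Pi.single_eq_of_ne hm, (u m).density_eq, trace_smul,
        trace_vecMulVec, dotProduct_comm, (u m).dotProduct_self] at this
      simpa using this.symm
    rw [Finset.sum_eq_single m₀ (fun m _ hm => by rw [h0 m hm, zero_mul]) (by simp)]
    have h1 := congrArg partialTraceA (h m₀)
    rw [Protocol.apply, Pi.single_eq_same, partialTraceA_vecMulVec] at h1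
    have h2 : partialTraceA ((q m₀ : ℂ) • (u m₀).density) = (q m₀ : ℂ) • (u m₀).rhoB := by
      ext j k
      simp [partialTraceA, PureState.rhoB, Finset.mul_sum]
    rw [h1, h2]
    simpa using hF _ 1 (fun _ => q m₀) (fun _ => (u m₀).rhoB) (fun _ => hq m₀)
      (fun _ => (u m₀).rhoB_posSemidef)
  | @alice a b n d K hK next ih =>
    intro v q hq u h
    refine (sum_le_of_runs F next ih
      (fun i => (K i ⊗ₖ (1 : Matrix (Fin b) (Fin b) ℂ)) *ᵥ v) q u fun m => ?_).trans ?_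
    · rw [← h m, Protocol.apply, Finset.sum_apply]
      simp only [conj_vecMulVec]
    · refine (hF' _ _ _ fun i => posSemidef_self_mul_conjTranspose _).trans_eq ?_
      congr 1
      -- The transposed completeness relation: `ρ_B` is the sum of the unnormalised reduced states
      -- after the measurement.
      have hK' : ∑ i, (K i)ᵀ * (K i)ᵀᴴ = 1 := by
        rw [← transpose_one (n := Fin a), ← hK, transpose_sum]
        refine Finset.sum_congr rfl fun i _ => ?_
        rw [transpose_mul]
        rfl
      calc ∑ i, _ = ∑ i, coeffMatrix v * ((K i)ᵀ * (K i)ᵀᴴ) * (coeffMatrix v)ᴴ :=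
            Finset.sum_congr rfl fun i _ => by
              rw [coeffMatrix_kronecker_one, conjTranspose_mul]
              simp only [Matrix.mul_assoc]
        _ = _ := by rw [← Matrix.sum_mul, ← Matrix.mul_sum, hK', Matrix.mul_one]
  | @bob a b n d K hK next ih =>
    intro v q hq u h
    refine (sum_le_of_runs F next ih
      (fun i => ((1 : Matrix (Fin a) (Fin a) ℂ) ⊗ₖ K i) *ᵥ v) q u fun m => ?_).trans ?_
    · rw [← h m, Protocol.apply, Finset.sum_apply]
      simp only [conj_vecMulVec]
    -- Bob's completeness relation collapses only inside `Cᴴ * C`, hence the passage to Alice's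
    -- side.
    · simp only [hFcomm]
      refine (hF' _ _ _ fun i => posSemidef_conjTranspose_mul_self _).trans_eq ?_
      congr 1
      calc ∑ i, _ = ∑ i, (coeffMatrix v)ᴴ * ((K i)ᴴ * K i) * coeffMatrix v :=
            Finset.sum_congr rfl fun i _ => by
              rw [coeffMatrix_one_kronecker, conjTranspose_mul]
              simp only [Matrix.mul_assoc]
        _ = _ := by rw [← Matrix.sum_mul, ← Matrix.mul_sum, hK, Matrix.mul_one]

theorem SLOCC.sum_mul_le {Ψ : PureState a b} {𝓔 : Ensemble ι a' b'} (h : SLOCC Ψ 𝓔) :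
    ∑ m, 𝓔.p m * F _ (𝓔.state m).rhoB ≤ F _ Ψ.rhoB := by
  obtain ⟨P, hP⟩ := h
  rw [Ψ.rhoB_eq]
  exact P.sum_mul_le F hF hFcomm Ψ.1 𝓔.p 𝓔.p_nonneg 𝓔.state fun m => by
    rw [← hP m, Ψ.density_eq]

end Monotone

theorem SLOCC.sum_schatten_le [Fintype ι] {Ψ : PureState a b} {𝓔 : Ensemble ι a' b'}
    (h : SLOCC Ψ 𝓔) {α : ℝ} (hα : 0 < α) (hα1 : α ≤ 1) :
    ∑ m, 𝓔.p m * (𝓔.state m).rhoB.schatten α ≤ Ψ.rhoB.schatten α :=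
  h.sum_mul_le (fun _ X => X.schatten α) (fun _ _ _ _ hc hX => Matrix.sum_schatten_le hα hα1 hc hX)
    fun _ _ A => schatten_mul_comm hα.ne' A Aᴴ

theorem SLOCC.schatten_le_sum [Fintype ι] {Ψ : PureState a b} {𝓔 : Ensemble ι a' b'}
    (h : SLOCC Ψ 𝓔) {α : ℝ} (hα : 1 ≤ α) :
    Ψ.rhoB.schatten α ≤ ∑ m, 𝓔.p m * (𝓔.state m).rhoB.schatten α := by
  have := h.sum_mul_le (fun _ X => -X.schatten α)
    (fun _ _ _ _ hc hX => by simpa using Matrix.schatten_sum_le hα hc hX)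
    fun _ _ A => by rw [schatten_mul_comm (by positivity) A Aᴴ]
  simpa using this

end Entanglement

namespace Entanglement

/-! ### Rényi entanglement entropies -/

section Entropy

variable {a b : ℕ} (Ψ : PureState a b)

theorem PureState.eigenvalues_nonneg (i : Fin b) : 0 ≤ Ψ.rhoB_isHermitian.eigenvalues i :=
  Ψ.rhoB_posSemidef.eigenvalues_nonneg i

theorem PureState.sum_eigenvalues : ∑ i, Ψ.rhoB_isHermitian.eigenvalues i = 1 := by
  have h := Ψ.rhoB_isHermitian.trace_eq_sum_eigenvalues
  rw [Ψ.trace_rhoB] at h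
  simp only [Complex.coe_algebraMap] at h
  exact_mod_cast h.symm

theorem PureState.eigenvalues_le_one (i : Fin b) : Ψ.rhoB_isHermitian.eigenvalues i ≤ 1 := by
  rw [← Ψ.sum_eigenvalues]
  exact Finset.single_le_sum (fun j _ => Ψ.eigenvalues_nonneg j) (Finset.mem_univ i)

theorem PureState.tracePow_pos (α : ℝ) : 0 < Ψ.rhoB.tracePow α := by
  rw [Ψ.rhoB_isHermitian.tracePow_eq]
  refine Finset.sum_pos' (fun i _ => Real.rpow_nonneg (Ψ.eigenvalues_nonneg i) α) ?_
  by_contra! h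
  refine one_ne_zero (Ψ.sum_eigenvalues.symm.trans (Finset.sum_eq_zero fun i hi => ?_))
  by_contra h0
  exact (Real.rpow_pos_of_pos ((Ψ.eigenvalues_nonneg i).lt_of_ne' h0) α).not_ge (h i hi)

theorem PureState.one_le_tracePow {α : ℝ} (hα : α ≤ 1) :
    1 ≤ Ψ.rhoB.tracePow α := by
  rw [Ψ.rhoB_isHermitian.tracePow_eq, ← Ψ.sum_eigenvalues]
  exact Finset.sum_le_sum fun i _ =>
    Real.self_le_rpow_of_le_one (Ψ.eigenvalues_nonneg i) (Ψ.eigenvalues_le_one i) hα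

theorem PureState.tracePow_le_one {α : ℝ} (hα : 1 ≤ α) : Ψ.rhoB.tracePow α ≤ 1 := by
  rw [Ψ.rhoB_isHermitian.tracePow_eq, ← Ψ.sum_eigenvalues]
  exact Finset.sum_le_sum fun i _ =>
    Real.rpow_le_self_of_le_one (Ψ.eigenvalues_nonneg i) (Ψ.eigenvalues_le_one i) hα

theorem REE_eq {α : ℝ} (hα : α ≠ 1) :
    REE α Ψ = 1 / (1 - α) * Real.log (Ψ.rhoB.tracePow α) := by
  rw [REE, renyiEntropy, if_neg hα, Ψ.rhoB_isHermitian.tracePow_eq]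

/-- The factor `(1 - α) / α` is the one that produces the outer power `1 / α`, and thus a functional
homogeneous of degree one. -/
theorem exp_mul_REE {α : ℝ} (hα : α ≠ 1) :
    Real.exp ((1 - α) / α * REE α Ψ) = Ψ.rhoB.schatten α := by
  have h1 : 1 - α ≠ 0 := sub_ne_zero.2 hα.symm
  rw [REE_eq Ψ hα, schatten, Real.rpow_def_of_pos (Ψ.tracePow_pos α)]
  congr 1
  field_simp

theorem REE_nonneg {α : ℝ} (hα : 0 < α) : 0 ≤ REE α Ψ := by
  rcases lt_trichotomy α 1 with h | rfl | h
  · rw [REE_eq Ψ h.ne]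
    exact mul_nonneg (one_div_nonneg.2 (sub_pos.2 h).le)
      (Real.log_nonneg (Ψ.one_le_tracePow h.le))
  · rw [REE, renyiEntropy, if_pos rfl, neg_nonneg]
    exact Finset.sum_nonpos fun i _ => mul_nonpos_of_nonneg_of_nonpos (Ψ.eigenvalues_nonneg i)
      (Real.log_nonpos (Ψ.eigenvalues_nonneg i) (Ψ.eigenvalues_le_one i))
  · rw [REE_eq Ψ h.ne']
    exact mul_nonneg_of_nonpos_of_nonpos (one_div_nonpos.2 (sub_neg.2 h).le)
      (Real.log_nonpos (Ψ.tracePow_pos α).le (Ψ.tracePow_le_one h.le))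

theorem PureState.tracePow_one : Ψ.rhoB.tracePow 1 = 1 := by
  simp [Ψ.rhoB_isHermitian.tracePow_eq, Ψ.sum_eigenvalues]

theorem PureState.schatten_one : Ψ.rhoB.schatten 1 = 1 := by
  simp [schatten, Ψ.tracePow_one]

theorem _root_.Real.hasDerivAt_const_rpow_one {x : ℝ} (hx : 0 ≤ x) :
    HasDerivAt (fun α : ℝ => x ^ α) (x * Real.log x) 1 := by
  rcases hx.eq_or_lt with rfl | hx
  -- Near `α = 1` the function `0 ^ α` is constantly zero, in agreement with `0 * log 0 = 0`.
  · have h : (fun _ => 0) =ᶠ[𝓝 (1 : ℝ)] fun α : ℝ => (0 : ℝ) ^ α := by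
      filter_upwards [eventually_ne_nhds one_ne_zero] with α hα
      rw [Real.zero_rpow hα]
    simpa using (hasDerivAt_const (1 : ℝ) (0 : ℝ)).congr_of_eventuallyEq h.symm
  · simpa using (Real.hasStrictDerivAt_const_rpow hx 1).hasDerivAt

theorem PureState.hasDerivAt_tracePow :
    HasDerivAt (fun α => Ψ.rhoB.tracePow α) (-REE 1 Ψ) 1 := by
  simp only [Ψ.rhoB_isHermitian.tracePow_eq, REE, renyiEntropy, if_true, neg_neg]
  exact HasDerivAt.fun_sum fun i _ => Real.hasDerivAt_const_rpow_one (Ψ.eigenvalues_nonneg i)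

/-- The von Neumann entropy is minus the derivative of the Schatten quasi-norm at order one. -/
theorem PureState.hasDerivAt_schatten :
    HasDerivAt (fun α => Ψ.rhoB.schatten α) (-REE 1 Ψ) 1 := by
  have h : HasDerivAt (fun α : ℝ => 1 / α) (-1) 1 := by
    simpa using hasDerivAt_inv (one_ne_zero (α := ℝ))
  have := Ψ.hasDerivAt_tracePow.rpow h (Ψ.tracePow_pos 1)
  simpa [schatten, Ψ.tracePow_one] using this

theorem tendsto_slope_schatten :
    Filter.Tendsto (fun α => (Ψ.rhoB.schatten α - 1) / (α - 1)) (𝓝[≠] 1) (𝓝 (-REE 1 Ψ)) := by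
  have := hasDerivAt_iff_tendsto_slope.1 Ψ.hasDerivAt_schatten
  simpa [Ψ.schatten_one, slope_fun_def_field] using this

theorem PGEE_eq {α : ℝ} (hα : α ≠ 1) (T : ℝ) :
    PGEE α Ψ T = (Ψ.rhoB.schatten α - 1) / (Real.exp ((1 - α) / α * T) - 1) := by
  rw [PGEE, if_neg hα, exp_mul_REE Ψ hα]

theorem tendsto_PGEE {T : ℝ} (hT : 0 < T) :
    Filter.Tendsto (fun α => PGEE α Ψ T) (𝓝[≠] 1) (𝓝 (PGEE 1 Ψ T)) := by
  have hd : HasDerivAt (fun α : ℝ => Real.exp ((1 - α) / α * T)) (-T) 1 := by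
    have h := ((((hasDerivAt_id (1 : ℝ)).const_sub 1).div (hasDerivAt_id (1 : ℝ))
      one_ne_zero).mul_const T).exp
    simpa using h
  have hs := hasDerivAt_iff_tendsto_slope.1 hd
  -- Numerator and denominator of `PGEE` both vanish at `α = 1`; their difference quotients tend to
  -- `-REE 1 Ψ` and `-T`.
  have h := (tendsto_slope_schatten Ψ).div hs (neg_ne_zero.2 hT.ne')
  rw [neg_div_neg_eq] at h
  rw [PGEE, if_pos rfl]
  refine h.congr' ?_
  filter_upwards [self_mem_nhdsWithin] with α hα
  have h1 : α - 1 ≠ 0 := sub_ne_zero.2 hα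
  rw [PGEE_eq Ψ hα, Pi.div_apply, slope_def_field]
  simp [div_div_div_cancel_right₀ h1]

end Entropy

/-! ### Properties of the bounds -/

/-- The bound is antitone in the exponent `s * (1 - α)` when the target is not below the initial
entropy. -/
theorem ratioBound_anti {α s s' E T : ℝ} (hE : 0 ≤ E) (hT : 0 < T) (hET : E ≤ T)
    (h : s * (1 - α) ≤ s' * (1 - α)) : ratioBound α s' E T ≤ ratioBound α s E T := by
  unfold ratioBound
  generalize s * (1 - α) = c at h ⊢
  generalize s' * (1 - α) = d at h ⊢
  have hθ0 : 0 ≤ E / T := div_nonneg hE hT.le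
  have hθ1 : E / T ≤ 1 := (div_le_one hT).2 hET
  -- With `y = exp (c * T)` and `θ = E / T` in `[0, 1]` the bound is `(y ^ θ - 1) / (y - 1)`, the
  -- slope of a secant through 1; the value `θ` for `c = 0` is the tangent slope.
  have hpow : ∀ c, Real.exp (c * E) = Real.exp (c * T) ^ (E / T) := fun c => by
    rw [← Real.exp_mul]
    congr 1
    field_simp
  -- Bernoulli's inequality compares secant and tangent, for the cases where exactly one exponent
  -- vanishes.
  have hbern : ∀ c, Real.exp (c * T) ^ (E / T) - 1 ≤ E / T * (Real.exp (c * T) - 1) := fun c => by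
    have := rpow_one_add_le_one_add_mul_self (s := Real.exp (c * T) - 1)
      (by linarith [Real.exp_pos (c * T)]) hθ0 hθ1
    rw [add_sub_cancel] at this
    linarith
  have hne : ∀ {c}, c ≠ 0 → Real.exp (c * T) ≠ 1 := fun hc => by
    simp [hc, hT.ne']
  simp only [hpow]
  split_ifs with hd hc hc
  · rfl
  · subst hd
    have : Real.exp (c * T) < 1 :=
      Real.exp_lt_one_iff.2 (mul_neg_of_neg_of_pos (h.lt_of_ne hc) hT)
    rw [le_div_iff_of_neg (by linarith)]
    exact hbern c
  · subst hc
    have : 1 < Real.exp (d * T) := Real.one_lt_exp_iff.2 (mul_pos (h.lt_of_ne' hd) hT)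
    rw [div_le_iff₀ (by linarith)]
    exact hbern d
  · have := (Real.concaveOn_rpow hθ0 hθ1).neg.secant_mono (a := 1) (x := Real.exp (c * T))
      (y := Real.exp (d * T)) (Set.mem_Ici.2 zero_le_one) (Real.exp_pos _).le (Real.exp_pos _).le
      (hne hc) (hne hd) (Real.exp_le_exp.2 (mul_le_mul_of_nonneg_right h hT.le))
    simp only [Pi.neg_apply, Real.one_rpow, neg_sub_neg] at this
    rwa [← neg_le_neg_iff, ← neg_div, ← neg_div, neg_sub, neg_sub]

theorem one_lt_ratioBound {α s E T : ℝ} (hT : 0 < T) (hTE : T < E) : 1 < ratioBound α s E T := by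
  unfold ratioBound
  split_ifs with hc
  · exact (one_lt_div hT).2 hTE
  · rcases lt_or_gt_of_ne hc with hc | hc
    · have h1 : Real.exp (s * (1 - α) * T) < 1 := Real.exp_lt_one_iff.2 (mul_neg_of_neg_of_pos hc hT)
      rw [one_lt_div_of_neg (by linarith)]
      have := Real.exp_lt_exp.2 (mul_lt_mul_of_neg_left hTE hc)
      linarith
    · have h1 : 1 < Real.exp (s * (1 - α) * T) := Real.one_lt_exp_iff.2 (mul_pos hc hT)
      rw [one_lt_div (by linarith)]
      have := Real.exp_lt_exp.2 (mul_lt_mul_of_pos_left hTE hc)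
      linarith

/-- Multiplication by `1 - α` reverses order exactly for `α > 1`, so both pieces of `Omega` become
the same upper bound on the exponent. -/
theorem mem_Omega_iff {α s : ℝ} (hα : 0 < α) (hα1 : α ≠ 1) :
    (α, s) ∈ Omega ↔ s * (1 - α) ≤ 1 / α * (1 - α) := by
  rcases lt_or_gt_of_ne hα1 with h | h
  · simp only [Omega, Set.mem_union, Set.mem_ofPred_eq, hα, h, h.not_gt, true_and, false_and,
      or_false]
    exact (mul_le_mul_iff_left₀ (sub_pos.2 h)).symm
  · simp only [Omega, Set.mem_union, Set.mem_ofPred_eq, hα, h, h.not_gt, true_and, false_and,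
      false_or]
    exact (mul_le_mul_right_of_neg (sub_neg.2 h)).symm

theorem pos_and_ne_one_of_mem_Omega {α s : ℝ} (h : (α, s) ∈ Omega) : 0 < α ∧ α ≠ 1 := by
  rcases h with ⟨h0, h1, -⟩ | ⟨h1, -⟩
  · exact ⟨h0, h1.ne⟩
  · exact ⟨zero_lt_one.trans h1, h1.ne'⟩

theorem ratioBound_one_div {a b : ℕ} (Ψ : PureState a b) {α : ℝ} (hα : 0 < α) (hα1 : α ≠ 1)
    (T : ℝ) : ratioBound α (1 / α) (REE α Ψ) T = PGEE α Ψ T := by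
  have h : 1 / α * (1 - α) ≠ 0 := mul_ne_zero (one_div_ne_zero hα.ne') (sub_ne_zero.2 hα1.symm)
  rw [ratioBound, if_neg h, PGEE, if_neg hα1, one_div_mul_eq_div]

/-! ### Conversion probabilities -/

section Probability

variable {a b : ℕ} {ι : Type*} [Fintype ι] {a' b' : ι → ℕ}

theorem Ensemble.prob_le_one (𝓔 : Ensemble ι a' b') (Γ : Set ι) : 𝓔.prob Γ ≤ 1 := by
  classical
  rw [Ensemble.prob, ← 𝓔.p_sum]
  exact Finset.sum_le_sum_of_subset_of_nonneg (Finset.filter_subset _ _) fun m _ _ => 𝓔.p_nonneg m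

/-- Markov's inequality. -/
theorem Ensemble.prob_mul_le (𝓔 : Ensemble ι a' b') {Γ : Set ι} {g : ι → ℝ} {t : ℝ}
    (hg : ∀ m, 0 ≤ g m) (ht : ∀ m ∈ Γ, t ≤ g m) : 𝓔.prob Γ * t ≤ ∑ m, 𝓔.p m * g m := by
  classical
  rw [Ensemble.prob, Finset.sum_mul]
  refine (Finset.sum_le_sum fun m hm => mul_le_mul_of_nonneg_left
    (ht m (Finset.mem_filter.1 hm).2) (𝓔.p_nonneg m)).trans ?_
  exact Finset.sum_le_sum_of_subset_of_nonneg (Finset.filter_subset _ _)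
    fun m _ _ => mul_nonneg (𝓔.p_nonneg m) (hg m)

variable {Ψ : PureState a b} {𝓔 : Ensemble ι a' b'}

/-- The average von Neumann entanglement entropy does not increase. -/
theorem SLOCC.sum_REE_one_le (h : SLOCC Ψ 𝓔) : ∑ m, 𝓔.p m * REE 1 (𝓔.state m) ≤ REE 1 Ψ := by
  have hle : 𝓝[<] (1 : ℝ) ≤ 𝓝[≠] 1 := nhdsWithin_mono _ fun x hx => ne_of_lt hx
  have hl := (tendsto_slope_schatten Ψ).mono_left hle
  have hr := tendsto_finsetSum Finset.univ fun m _ =>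
    ((tendsto_slope_schatten (𝓔.state m)).mono_left hle).const_mul (𝓔.p m)
  have := le_of_tendsto_of_tendsto hl hr (by
    -- Every quasi-norm equals 1 at `α = 1`, and division by `α - 1 < 0` reverses the monotonicity
    -- for `α < 1`.
    filter_upwards [Ioo_mem_nhdsLT (zero_lt_one (α := ℝ))] with α hα
    have h1 := h.sum_schatten_le hα.1 hα.2.le
    simp only [← mul_div_assoc, ← Finset.sum_div, mul_sub, mul_one, Finset.sum_sub_distrib,
      𝓔.p_sum]
    rw [div_le_div_right_of_neg (sub_neg.2 hα.2)]
    linarith)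
  simpa using this

/-- Markov's inequality for a nonnegative quantity that does not increase on average: quasi-norm
minus 1 for `α < 1`, the entropy for `α = 1`, 1 minus the norm for `α > 1`. -/
theorem SLOCC.prob_le_PGEE (h : SLOCC Ψ 𝓔) {α T : ℝ} (hα : 0 < α) (hT : 0 < T) :
    𝓔.prob {m | T ≤ REE α (𝓔.state m)} ≤ PGEE α Ψ T := by
  rcases lt_trichotomy α 1 with h1 | rfl | h1
  · have hc : 0 < (1 - α) / α := div_pos (sub_pos.2 h1) hα
    have ht : 1 < Real.exp ((1 - α) / α * T) := Real.one_lt_exp_iff.2 (mul_pos hc hT)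
    rw [PGEE_eq Ψ h1.ne, le_div_iff₀ (by linarith)]
    refine (𝓔.prob_mul_le (g := fun m => (𝓔.state m).rhoB.schatten α - 1) (fun m => ?_)
      fun m hm => ?_).trans ?_
    · rw [← exp_mul_REE _ h1.ne, sub_nonneg]
      exact Real.one_le_exp (mul_nonneg hc.le (REE_nonneg _ hα))
    · rw [← exp_mul_REE _ h1.ne]
      exact sub_le_sub_right (Real.exp_le_exp.2 (mul_le_mul_of_nonneg_left hm hc.le)) _
    · simp only [mul_sub, mul_one, Finset.sum_sub_distrib, 𝓔.p_sum]
      exact sub_le_sub_right (h.sum_schatten_le hα h1.le) _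
  · rw [PGEE, if_pos rfl, le_div_iff₀ hT]
    exact (𝓔.prob_mul_le (fun m => REE_nonneg _ hα) fun m hm => hm).trans h.sum_REE_one_le
  · have hc : (1 - α) / α < 0 := div_neg_of_neg_of_pos (sub_neg.2 h1) hα
    have ht : Real.exp ((1 - α) / α * T) < 1 := Real.exp_lt_one_iff.2 (mul_neg_of_neg_of_pos hc hT)
    rw [PGEE_eq Ψ h1.ne', ← neg_div_neg_eq, neg_sub, neg_sub, le_div_iff₀ (by linarith)]
    refine (𝓔.prob_mul_le (g := fun m => 1 - (𝓔.state m).rhoB.schatten α) (fun m => ?_)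
      fun m hm => ?_).trans ?_
    · rw [← exp_mul_REE _ h1.ne', sub_nonneg]
      exact Real.exp_le_one_iff.2 (mul_nonpos_of_nonpos_of_nonneg hc.le (REE_nonneg _ hα))
    · rw [← exp_mul_REE _ h1.ne']
      exact sub_le_sub_left (Real.exp_le_exp.2 (mul_le_mul_of_nonpos_left hm hc.le)) _
    · simp only [mul_sub, mul_one, Finset.sum_sub_distrib, 𝓔.p_sum]
      exact sub_le_sub_left (h.schatten_le_sum h1.le) _

theorem SLOCC.prob_le_ratioBound (h : SLOCC Ψ 𝓔) {α s T : ℝ} (hs : (α, s) ∈ Omega) (hT : 0 < T) :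
    𝓔.prob {m | T ≤ REE α (𝓔.state m)} ≤ ratioBound α s (REE α Ψ) T := by
  obtain ⟨hα, hα1⟩ := pos_and_ne_one_of_mem_Omega hs
  rcases le_or_gt (REE α Ψ) T with hE | hE
  · refine (h.prob_le_PGEE hα hT).trans ?_
    rw [← ratioBound_one_div Ψ hα hα1]
    exact ratioBound_anti (REE_nonneg Ψ hα) hT hE ((mem_Omega_iff hα hα1).1 hs)
  · exact (𝓔.prob_le_one _).trans (one_lt_ratioBound hT hE).le

/-- Markov's inequality for the quasi-norm itself, without subtracting 1, so that the threshold may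
have any sign. -/
theorem SLOCC.prob_le_exp (h : SLOCC Ψ 𝓔) {α : ℝ} (hα : 0 < α) (hα1 : α < 1) (x : ℝ) :
    𝓔.prob {m | x ≤ REE α (𝓔.state m) - REE α Ψ} ≤ Real.exp (-((1 - α) / α) * x) := by
  have hc : 0 < (1 - α) / α := div_pos (sub_pos.2 hα1) hα
  have key : 𝓔.prob {m | x ≤ REE α (𝓔.state m) - REE α Ψ} *
      Real.exp ((1 - α) / α * (REE α Ψ + x)) ≤ Real.exp ((1 - α) / α * REE α Ψ) := by
    rw [exp_mul_REE Ψ hα1.ne]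
    refine (𝓔.prob_mul_le (fun m => ?_) fun m hm => ?_).trans (h.sum_schatten_le hα hα1.le)
    · rw [← exp_mul_REE _ hα1.ne]
      exact (Real.exp_pos _).le
    · rw [← exp_mul_REE _ hα1.ne]
      exact Real.exp_le_exp.2 (mul_le_mul_of_nonneg_left (le_sub_iff_add_le'.1 hm) hc.le)
  rw [← le_div_iff₀ (Real.exp_pos _), ← Real.exp_sub] at key
  refine key.trans_eq (congrArg Real.exp ?_)
  ring

end Probability

end Entanglement

theorem proposition2 {a b : ℕ} {ι : Type*} [Fintype ι] {a' b' : ι → ℕ}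
    (Ψ : Entanglement.PureState a b) (𝓔 : Entanglement.Ensemble ι a' b')
    (h : Entanglement.SLOCC Ψ 𝓔) :
    -- the bound for all `(α, s) ∈ Ω`
    (∀ α s T : ℝ, (α, s) ∈ Entanglement.Omega → 0 < T →
      𝓔.prob {m | T ≤ Entanglement.REE α (𝓔.state m)} ≤
        Entanglement.ratioBound α s (Entanglement.REE α Ψ) T) ∧
    -- it is minimised at `s = 1 / α`, where it equals `P^GEE_α`, as soon as it is not trivial
    (∀ α T : ℝ, 0 < α → α ≠ 1 → 0 < T →
      (α, 1 / α) ∈ Entanglement.Omega ∧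
      Entanglement.ratioBound α (1 / α) (Entanglement.REE α Ψ) T = Entanglement.PGEE α Ψ T ∧
      (Entanglement.REE α Ψ ≤ T →
        IsMinOn (fun s => Entanglement.ratioBound α s (Entanglement.REE α Ψ) T)
          {s | (α, s) ∈ Entanglement.Omega} (1 / α)) ∧
      (T < Entanglement.REE α Ψ →
        ∀ s, (α, s) ∈ Entanglement.Omega →
          1 < Entanglement.ratioBound α s (Entanglement.REE α Ψ) T)) ∧
    -- the bound `P^GEE_α` for all `α > 0`; its value at `α = 1` is the limit `α → 1`
    (∀ α T : ℝ, 0 < α → 0 < T →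
      𝓔.prob {m | T ≤ Entanglement.REE α (𝓔.state m)} ≤ Entanglement.PGEE α Ψ T) ∧
    (∀ T : ℝ, 0 < T →
      Filter.Tendsto (fun α => Entanglement.PGEE α Ψ T) (𝓝[≠] 1)
        (𝓝 (Entanglement.PGEE 1 Ψ T))) ∧
    -- exponential decay in the raised entanglement
    (∀ α x : ℝ, 0 < α → α < 1 →
      𝓔.prob {m | x ≤ Entanglement.REE α (𝓔.state m) - Entanglement.REE α Ψ} ≤
        Real.exp (-((1 - α) / α) * x)) := by
  refine ⟨fun α s T hs hT => h.prob_le_ratioBound hs hT, fun α T hα hα1 hT => ⟨?_, ?_, ?_, ?_⟩,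
    fun α T hα hT => h.prob_le_PGEE hα hT, fun T hT => Entanglement.tendsto_PGEE Ψ hT,
    fun α x hα hα1 => h.prob_le_exp hα hα1 x⟩
  · exact (Entanglement.mem_Omega_iff hα hα1).2 le_rfl
  · exact Entanglement.ratioBound_one_div Ψ hα hα1 T
  · intro hE s hs
    exact Entanglement.ratioBound_anti (Entanglement.REE_nonneg Ψ hα) hT hE
      ((Entanglement.mem_Omega_iff hα hα1).1 hs)
  · exact fun hE s _ => Entanglement.one_lt_ratioBound hT hE
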